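/- Let $m\ge 1$, let $X_1,\dots,X_{m+1}$ be (real or complex) Banach spaces, let $0<s_k\le 2$ and let $T_k:X_k\to X_{k+1}$ be $(s_k;2)$-nuclear operators for $k=1,\dots,m$. Let $s\in(0,\infty]$ be given by $1/s=\sum_{k=1}^m 1/s_k-1/2$ and let $0<t\le s$ (with $1/\infty=0$). If the operator $T:=T_mT_{m-1}\cdots T_1$ has finite rank, then $T$ factors through an operator of class $S_t$ on a Hilbert space, and $$\gamma_{S_t}(T)\le (\dim T(X_1))^{1/t-1/s}\prod_{k=1}^m\nu_{s_k;2}(T_k),$$ where $0^0=1$. Here a bounded linear operator $R:X\to Y$ between Banach spaces is called $(r;2)$-nuclear if $Rx=\sum_{n=1}^\infty a_n\langle x_n',x\rangle y_n$ for all $x\in X$, where $x'_n\in X^*$, $\|x_n'\|\le 1$, $(a_n)\in\ell_r$, $y_n\in Y$ and $\|(y_n)\|_2^{\mathrm{weak}}:=\sup_{\|y'\|\le1}\bigl(\sum_n|\langle y',y_n\rangle|^2\bigr)^{1/2}<\infty$; $\nu_{r;2}(R)$ is the infimum of $\|(a_n)\|_{\ell_r}$ over all such representations with $\|(y_n)\|_2^{\mathrm{weak}}\le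 1$. For a Hilbert space $H$, $S_p(H)$ ($0<p\le\infty$) is the class of compact operators $U:H\to H$ whose sequence $(\mu_n)$ of singular numbers (the eigenvalues of $(U^*U)^{1/2}$, in decreasing order and with multiplicities) lies in $\ell_p$, and $\sigma_p(U)=\|(\mu_n)\|_{\ell_p}$. Finally, $R$ factors through an operator of class $S_p$ if $R=BUA$ with $A\in L(X,H)$, $U\in S_p(H)$, $B\in L(H,Y)$ for some Hilbert space $H$, and $\gamma_{S_p}(R)=\inf\|A\|\,\sigma_p(U)\,\|B\|$ over all such factorizations. -/

import Mathlib

open scoped ENNReal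

universe u w

noncomputable section

/-- The `ℓ_p` quasi-norm of a sequence, `0 < p ≤ ∞`, with value `∞` off `ℓ_p`. -/
def ellNorm {E : Type*} [ENorm E] (p : ℝ≥0∞) (a : ℕ → E) : ℝ≥0∞ :=
  if p = ∞ then ⨆ n, ‖a n‖ₑ else (∑' n, ‖a n‖ₑ ^ p.toReal) ^ (1 / p.toReal)

section Nuclear

variable {𝕜 : Type*} [RCLike 𝕜]
variable {X : Type*} [NormedAddCommGroup X] [NormedSpace 𝕜 X]
variable {Y : Type*} [NormedAddCommGroup Y] [NormedSpace 𝕜 Y]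

/-- The weak `ℓ_2` norm `sup_{‖y'‖ ≤ 1} (∑ |⟨y', y n⟩|²)^{1/2}` of a sequence in `Y`. -/
def weakTwoNorm (𝕜 : Type*) [RCLike 𝕜] {Y : Type*} [NormedAddCommGroup Y] [NormedSpace 𝕜 Y]
    (y : ℕ → Y) : ℝ≥0∞ :=
  ⨆ (y' : StrongDual 𝕜 Y) (_ : ‖y'‖ ≤ 1), ellNorm 2 (fun n => y' (y n))

/-- `T x = ∑ a_n ⟨x'_n, x⟩ y_n` for all `x`, with all `‖x'_n‖ ≤ 1`. -/
def Represents (T : X →L[𝕜] Y) (a : ℕ → 𝕜) (x' : ℕ → StrongDual 𝕜 X) (y : ℕ → Y) : Prop :=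
  (∀ n, ‖x' n‖ ≤ 1) ∧ ∀ x, HasSum (fun n => a n • x' n x • y n) (T x)

/-- `T` is `(s;2)`-nuclear. -/
def IsNuclearTwo (s : ℝ≥0∞) (T : X →L[𝕜] Y) : Prop :=
  ∃ (a : ℕ → 𝕜) (x' : ℕ → StrongDual 𝕜 X) (y : ℕ → Y),
    Represents T a x' y ∧ ellNorm s a < ∞ ∧ weakTwoNorm 𝕜 y < ∞

/-- The quasi-norm `ν_{s;2}(T)`: the infimum of `‖(a_n)‖_{ℓ_s}` over the representations of `T`
in which `(y_n)` is normalized by `‖(y_n)‖_2^weak ≤ 1`. -/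
def nuTwo (s : ℝ≥0∞) (T : X →L[𝕜] Y) : ℝ≥0∞ :=
  sInf {c | ∃ (a : ℕ → 𝕜) (x' : ℕ → StrongDual 𝕜 X) (y : ℕ → Y),
    Represents T a x' y ∧ weakTwoNorm 𝕜 y ≤ 1 ∧ c = ellNorm s a}

end Nuclear

section Schatten

variable {𝕜 : Type*} [RCLike 𝕜]
variable {H : Type*} [NormedAddCommGroup H] [InnerProductSpace 𝕜 H] [CompleteSpace H]

/-- The singular numbers of a compact operator `U`: the eigenvalues of `|U| = (U* U)^{1/2}`, that
is, the numbers `σ ≥ 0` for which `σ²` is an eigenvalue of `U* U`, in decreasing order and with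
multiplicities. The indices start at `0`, and the value is `0` beyond the last positive eigenvalue.
Thus `singularNumber U n` is the largest `τ > 0` such that at least `n + 1` eigenvalues of `|U|`,
counted with multiplicity, are `≥ τ`. -/
def singularNumber (U : H →L[𝕜] H) (n : ℕ) : ℝ :=
  sSup {τ : ℝ | 0 < τ ∧ n < Module.finrank 𝕜
    (⨆ (σ : ℝ) (_ : τ ≤ σ), Module.End.eigenspace
      ((ContinuousLinearMap.adjoint U ∘L U : H →L[𝕜] H) : H →ₗ[𝕜] H) ((σ ^ 2 : ℝ) : 𝕜) :
        Submodule 𝕜 H)}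

/-- The Schatten quasi-norm `σ_p(U)`. -/
def schattenNorm (p : ℝ≥0∞) (U : H →L[𝕜] H) : ℝ≥0∞ :=
  ellNorm p (singularNumber U)

/-- `U` belongs to the Schatten class `S_p(H)`; `S_∞(H)` consists of the compact operators. -/
def MemSchatten (p : ℝ≥0∞) (U : H →L[𝕜] H) : Prop :=
  IsCompactOperator U ∧ schattenNorm p U < ∞

end Schatten

section Factorization

variable {𝕜 : Type*} [RCLike 𝕜]
variable {X : Type*} [NormedAddCommGroup X] [NormedSpace 𝕜 X]
variable {Y : Type*} [NormedAddCommGroup Y] [NormedSpace 𝕜 Y]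

/-- The numbers `‖A‖ σ_p(U) ‖B‖` over all factorizations `T = B U A` through an operator
`U ∈ S_p(H)` on a Hilbert space `H`. -/
def schattenFactorizationValues (p : ℝ≥0∞) (T : X →L[𝕜] Y) : Set ℝ≥0∞ :=
  {c | ∃ (H : Type w) (_ : NormedAddCommGroup H) (_ : InnerProductSpace 𝕜 H)
    (_ : CompleteSpace H) (A : X →L[𝕜] H) (U : H →L[𝕜] H) (B : H →L[𝕜] Y),
    MemSchatten p U ∧ T = B ∘L U ∘L A ∧ c = ‖A‖ₑ * schattenNorm p U * ‖B‖ₑ}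

/-- `T` factors through an operator of class `S_p` on a Hilbert space. -/
def FactorsThroughSchatten (p : ℝ≥0∞) (T : X →L[𝕜] Y) : Prop :=
  (schattenFactorizationValues.{w} p T).Nonempty

/-- The quasi-norm `γ_{S_p}(T)`. -/
def gammaSchatten (p : ℝ≥0∞) (T : X →L[𝕜] Y) : ℝ≥0∞ :=
  sInf (schattenFactorizationValues.{w} p T)

end Factorization

/-- The product `T_m ⋯ T_2 T_1` of a chain of operators `X_1 → X_2 → ⋯ → X_{m+1}`; the indices of
the spaces and of the operators start at `0`. -/
def chainProd {𝕜 : Type*} [RCLike 𝕜] : {m : ℕ} → (X : Fin (m + 1) → Type u) →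
    [∀ i, NormedAddCommGroup (X i)] → [∀ i, NormedSpace 𝕜 (X i)] →
    (∀ k : Fin m, X k.castSucc →L[𝕜] X k.succ) → (X 0 →L[𝕜] X (Fin.last m))
  | 0, X, _, _, _ => ContinuousLinearMap.id 𝕜 (X 0)
  | m + 1, X, _, _, T =>
      T (Fin.last m) ∘L chainProd (fun i => X i.castSucc) (fun k => T k.castSucc)

end

/-! Split each coefficient sequence as `a = c b` with `b` in `ℓ_2` and `c` in `ℓ_r`, `1/r = 1/s_k -
1/2`. Then `T_k = B_k D_k A_k` through `ℓ_2`: `A_k` has rows `b_n x'_n`, `D_k` is the diagonal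
operator of `c`, and `B_k` is the contraction `x ↦ ∑ x_n y_n`. In the chain, `A_{k+1} B_k` acts
between Hilbert spaces and is Hilbert-Schmidt, so `T = B_m U A_1` with `U = D_m (A_m B_{m-1})
D_{m-1} ⋯ (A_2 B_1) D_1`. Each operator contributes `1/s_k` to the exponent, except that `A_1` stays
outside `U` and costs `1/2`; this gives `1/s = ∑ 1/s_k - 1/2`.

Hölder's inequality for Schatten classes is replaced by `TriangularBound`: it is submultiplicative
by Gram-Schmidt (`TriangularBound.comp`) and holds for diagonal operators
(`TriangularBound.diagonal`) and Hilbert-Schmidt ones (`TriangularBound.of_rows`).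

For finite rank `N`, `U` is compressed to a subspace of dimension exactly `N`
(`exists_schattenFactorizationValues_le`). In its singular vectors the matrix of the compression is
diagonal, so the triangular bound controls the `ℓ_s` quasi-norm of its `N` singular numbers, and
Hölder on `N` points gives the factor `N^{1/t-1/s}`. -/

/-! ### Triangular bounds and their submultiplicativity. -/

section TriangularBound

open MeasureTheory

variable {𝕜 : Type*} [RCLike 𝕜]
variable {E : Type*} [NormedAddCommGroup E] [InnerProductSpace 𝕜 E]
variable {F : Type*} [NormedAddCommGroup F] [InnerProductSpace 𝕜 F]
variable {G : Type*} [NormedAddCommGroup G] [InnerProductSpace 𝕜 G]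

local notation "⟪" x ", " y "⟫" => inner 𝕜 x y

/-- In every pair of finite orthonormal systems in which the matrix of `U` is triangular and
invertible, the diagonal of that matrix has `ℓ_p` quasi-norm at most `M`. For `p`-Schatten operators
this holds with `M = σ_p(U)`; unlike `σ_p`, it is obviously submultiplicative. -/
def TriangularBound (p M : ℝ≥0∞) (U : E →L[𝕜] F) : Prop :=
  ∀ (N : ℕ) (e : Fin N → E) (f : Fin N → F), Orthonormal 𝕜 e → Orthonormal 𝕜 f →
    (∀ i j, i < j → ⟪f j, U (e i)⟫ = 0) → (∀ i, ⟪f i, U (e i)⟫ ≠ 0) →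
      eLpNorm (fun i => ⟪f i, U (e i)⟫) p Measure.count ≤ M

/-- Vectors whose matrix against some system is triangular with nonzero diagonal are linearly
independent. -/
theorem linearIndependent_of_triangular {N : ℕ} {v f : Fin N → F}
    (h0 : ∀ i j, i < j → ⟪f j, v i⟫ = 0) (h1 : ∀ i, ⟪f i, v i⟫ ≠ 0) : LinearIndependent 𝕜 v := by
  rw [Fintype.linearIndependent_iff]
  intro g hg
  by_contra! h
  let S : Finset (Fin N) := {i | g i ≠ 0}
  have hS : S.Nonempty := by obtain ⟨i, hi⟩ := h; exact ⟨i, by simpa [S] using hi⟩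
  let k := S.max' hS
  have hk : g k ≠ 0 := by simpa [S] using S.max'_mem hS
  have hmax : ∀ i, k < i → g i = 0 := by
    intro i hi
    by_contra hne
    exact absurd (S.le_max' i (by simpa [S] using hne)) (not_le.2 hi)
  have h2 : ⟪f k, ∑ i, g i • v i⟫ = g k * ⟪f k, v k⟫ := by
    rw [inner_sum, Finset.sum_eq_single k]
    · rw [inner_smul_right]
    · intro i _ hik
      rw [inner_smul_right]
      rcases lt_or_gt_of_ne hik with h | h
      · rw [h0 i k h, mul_zero]
      · rw [hmax i h, zero_mul]
    · simp
  rw [hg, inner_zero_right] at h2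
  exact mul_ne_zero hk (h1 k) h2.symm

/-- Orthonormalizing the vectors `U (e i)` gives an intermediate system `g` in which both factors
are triangular. Hence the diagonal of the product is the product of the diagonals, and Hölder's
inequality applies. The nonzero diagonal guarantees that Gram-Schmidt does not degenerate. -/
theorem TriangularBound.comp {p q r M₁ M₂ : ℝ≥0∞} {V : F →L[𝕜] G} {U : E →L[𝕜] F}
    (hV : TriangularBound q M₂ V) (hU : TriangularBound p M₁ U) (hr : q⁻¹ + p⁻¹ = r⁻¹) :
    TriangularBound r (M₂ * M₁) (V ∘L U) := by
  intro N e f he hf h0 h1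
  simp only [ContinuousLinearMap.comp_apply] at h0 h1 ⊢
  have hli : LinearIndependent 𝕜 (fun i => U (e i)) :=
    LinearIndependent.of_comp V.toLinearMap (linearIndependent_of_triangular h0 h1)
  let g := InnerProductSpace.gramSchmidtNormed 𝕜 (fun i => U (e i))
  have hg : Orthonormal 𝕜 g := InnerProductSpace.gramSchmidtNormed_orthonormal hli
  have hspan (i : Fin N) : Submodule.span 𝕜 (g '' Set.Iic i) =
      Submodule.span 𝕜 ((fun i => U (e i)) '' Set.Iic i) := by
    rw [InnerProductSpace.span_gramSchmidtNormed, InnerProductSpace.span_gramSchmidt_Iic]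
  have hU0 : ∀ i j, i < j → ⟪g j, U (e i)⟫ = 0 := by
    intro i j hij
    simp only [g, InnerProductSpace.gramSchmidtNormed, inner_smul_left]
    rw [InnerProductSpace.gramSchmidt_inv_triangular 𝕜 (fun i => U (e i)) hij, mul_zero]
  have hV0 : ∀ i j, i < j → ⟪f j, V (g i)⟫ = 0 := by
    intro i j hij
    have hmem : g i ∈ Submodule.span 𝕜 ((fun i => U (e i)) '' Set.Iic i) := by
      rw [← hspan]
      exact Submodule.subset_span ⟨i, Set.self_mem_Iic, rfl⟩
    generalize g i = z at hmem
    induction hmem using Submodule.span_induction with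
    | mem x hx =>
      obtain ⟨l, hl, rfl⟩ := hx
      exact h0 l j (lt_of_le_of_lt hl hij)
    | zero => simp
    | add x y _ _ hx hy => rw [map_add, inner_add_right, hx, hy, add_zero]
    | smul c x _ hx => rw [map_smul, inner_smul_right, hx, mul_zero]
  have hdiag : ∀ i, ⟪f i, V (U (e i))⟫ = ⟪f i, V (g i)⟫ * ⟪g i, U (e i)⟫ := by
    intro i
    have hmem : U (e i) ∈ Submodule.span 𝕜 (g '' Set.Iic i) := by
      rw [hspan]
      exact Submodule.subset_span ⟨i, Set.self_mem_Iic, rfl⟩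
    generalize U (e i) = z at hmem
    induction hmem using Submodule.span_induction with
    | mem x hx =>
      obtain ⟨l, hl, rfl⟩ := hx
      rcases (show l ≤ i from hl).eq_or_lt with rfl | hl
      · rw [inner_self_eq_norm_sq_to_K, hg.1]; simp
      · rw [hV0 l i hl, hg.2 hl.ne', mul_zero]
    | zero => simp
    | add x y _ _ hx hy => rw [map_add, inner_add_right, hx, hy, inner_add_right, mul_add]
    | smul c x _ hx => rw [map_smul, inner_smul_right, hx, inner_smul_right]; ring
  have hne i := mul_ne_zero_iff.1 (hdiag i ▸ h1 i)
  have : ENNReal.HolderTriple q p r := ⟨hr⟩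
  calc eLpNorm (fun i => ⟪f i, V (U (e i))⟫) r Measure.count
      = eLpNorm ((fun i => ⟪f i, V (g i)⟫) • (fun i => ⟪g i, U (e i)⟫)) r Measure.count := by
        congr 1; funext i; exact hdiag i
    _ ≤ eLpNorm (fun i => ⟪f i, V (g i)⟫) q Measure.count *
          eLpNorm (fun i => ⟪g i, U (e i)⟫) p Measure.count :=
        eLpNorm_smul_le_mul_eLpNorm .of_discrete .of_discrete
    _ ≤ M₂ * M₁ := by
        gcongr
        · exact hV N g f hg hf hV0 fun i => (hne i).1
        · exact hU N e g he hg hU0 fun i => (hne i).2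

theorem eLpNorm_count_fin_two {α : Type*} [Fintype α] [MeasurableSpace α]
    [MeasurableSingletonClass α] {K : Type*} [NormedAddCommGroup K] (h : α → K) :
    eLpNorm h 2 Measure.count = (∑ i, ‖h i‖ₑ ^ 2) ^ (1 / 2 : ℝ) := by
  rw [eLpNorm_eq_lintegral_rpow_enorm_toReal (by simp) (by simp), lintegral_count, tsum_fintype]
  simp

end TriangularBound

/-! ### Triangular bounds for diagonal and Hilbert-Schmidt operators on `ℓ_2`. -/

section SequenceSpace

open MeasureTheory

variable {𝕜 : Type*} [RCLike 𝕜]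

local notation "⟪" x ", " y "⟫" => inner 𝕜 x y

theorem lp_two_enorm_sq (x : lp (fun _ : ℕ => 𝕜) 2) : ‖x‖ₑ ^ 2 = ∑' n, ‖x n‖ₑ ^ 2 := by
  have h := lp.hasSum_norm (p := 2) (by simp) x
  simp only [ENNReal.toReal_ofNat, Real.rpow_ofNat] at h
  have h2 := ENNReal.ofReal_tsum_of_nonneg (fun n => sq_nonneg ‖x n‖) h.summable
  rw [h.tsum_eq] at h2
  simpa only [ENNReal.ofReal_pow (norm_nonneg _), ofReal_norm] using h2

theorem memℓp_two_of_tsum_ne_top {a : ℕ → 𝕜} (h : ∑' n, ‖a n‖ₑ ^ 2 ≠ ∞) : Memℓp a 2 := by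
  refine memℓp_gen ?_
  have := ENNReal.summable_toReal h
  simpa using this

theorem two_mul_enorm_mul_le (a b : 𝕜) : 2 * (‖a‖ₑ * ‖b‖ₑ) ≤ ‖a‖ₑ ^ 2 + ‖b‖ₑ ^ 2 := by
  simp only [enorm]
  norm_cast
  rw [← mul_assoc]
  exact two_mul_le_add_sq _ _

theorem Orthonormal.sum_enorm_inner_sq_le {E : Type*} [NormedAddCommGroup E]
    [InnerProductSpace 𝕜 E] {N : ℕ} {e : Fin N → E} (he : Orthonormal 𝕜 e) (x : E) :
    ∑ i, ‖⟪e i, x⟫‖ₑ ^ 2 ≤ ‖x‖ₑ ^ 2 := by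
  have h := he.sum_inner_products_le x (s := Finset.univ)
  simp only [← ofReal_norm, ← ENNReal.ofReal_pow (norm_nonneg _)]
  rw [← ENNReal.ofReal_sum_of_nonneg (fun i _ => sq_nonneg _)]
  exact ENNReal.ofReal_le_ofReal h

/-- Bessel's inequality for the values of a functional. -/
theorem Orthonormal.sum_enorm_dual_sq_le {E : Type*} [NormedAddCommGroup E]
    [InnerProductSpace 𝕜 E] [CompleteSpace E] {N : ℕ} {e : Fin N → E} (he : Orthonormal 𝕜 e)
    (φ : StrongDual 𝕜 E) : ∑ i, ‖φ (e i)‖ₑ ^ 2 ≤ ‖φ‖ₑ ^ 2 := by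
  obtain ⟨z, rfl⟩ := (InnerProductSpace.toDual 𝕜 E).surjective φ
  have h := he.sum_enorm_inner_sq_le z
  have h1 : ‖InnerProductSpace.toDual 𝕜 E z‖ₑ = ‖z‖ₑ := by
    rw [← ofReal_norm, ← ofReal_norm, LinearIsometryEquiv.norm_map]
  rw [h1]
  refine le_trans (le_of_eq ?_) h
  refine Finset.sum_congr rfl fun i _ => ?_
  rw [InnerProductSpace.toDual_apply_apply, ← ofReal_norm, ← ofReal_norm, norm_inner_symm]

theorem lp_two_orthonormal_sum_sq_le {N : ℕ} {e : Fin N → lp (fun _ : ℕ => 𝕜) 2}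
    (he : Orthonormal 𝕜 e) (n : ℕ) : ∑ i, ‖e i n‖ₑ ^ 2 ≤ 1 := by
  classical
  have h := he.sum_enorm_inner_sq_le (lp.single 2 n (1 : 𝕜))
  have h1 : ‖(lp.single 2 n (1 : 𝕜) : lp (fun _ : ℕ => 𝕜) 2)‖ₑ = 1 := by
    rw [← ofReal_norm, lp.norm_single (by norm_num)]; simp
  rw [h1, one_pow] at h
  refine le_trans (le_of_eq (Finset.sum_congr rfl fun i _ => ?_)) h
  rw [lp.inner_single_right]
  simp [← ofReal_norm]

/-- The diagonal of a diagonal operator in a pair of orthonormal systems. -/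
theorem enorm_inner_diagonal_le {c : ℕ → 𝕜}
    {D : lp (fun _ : ℕ => 𝕜) 2 →L[𝕜] lp (fun _ : ℕ => 𝕜) 2} (hD : ∀ x n, D x n = c n * x n)
    (x y : lp (fun _ : ℕ => 𝕜) 2) :
    ‖⟪y, D x⟫‖ₑ ≤ ∑' n, ‖y n‖ₑ * ‖x n‖ₑ * ‖c n‖ₑ := by
  rw [lp.inner_eq_tsum]
  refine enorm_tsum_le_tsum_enorm.trans (ENNReal.tsum_le_tsum fun n => ?_)
  rw [hD, RCLike.inner_apply, enorm_mul, enorm_mul, RCLike.enorm_conj]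
  exact le_of_eq (by ring)

/-- The weights `‖f i n‖ ‖e i n‖` have row and column sums at most `1`, by `2ab ≤ a² + b²` and
Bessel. Convexity of `x ↦ x^r`, which needs `r ≥ 1`, then bounds the averaged entries. -/
theorem TriangularBound.diagonal_of_one_le {r : ℝ≥0∞} (hr : 1 ≤ r) {c : ℕ → 𝕜}
    {D : lp (fun _ : ℕ => 𝕜) 2 →L[𝕜] lp (fun _ : ℕ => 𝕜) 2} (hD : ∀ x n, D x n = c n * x n) :
    TriangularBound r (ellNorm r c) D := by
  intro N e f he hf _ _
  have hrow (i : Fin N) : ∑' n, ‖f i n‖ₑ * ‖e i n‖ₑ ≤ 1 := by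
    have h2 : 2 * ∑' n, ‖f i n‖ₑ * ‖e i n‖ₑ ≤ 2 * 1 := by
      rw [← ENNReal.tsum_mul_left]
      calc ∑' n, 2 * (‖f i n‖ₑ * ‖e i n‖ₑ) ≤ ∑' n, (‖f i n‖ₑ ^ 2 + ‖e i n‖ₑ ^ 2) :=
            ENNReal.tsum_le_tsum fun n => two_mul_enorm_mul_le _ _
        _ = 2 * 1 := by
            rw [ENNReal.tsum_add, ← lp_two_enorm_sq, ← lp_two_enorm_sq, ← ofReal_norm,
              ← ofReal_norm, he.1, hf.1]
            norm_num
    rwa [ENNReal.mul_le_mul_iff_right (by norm_num) (by norm_num)] at h2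
  have hcol (n : ℕ) : ∑ i, ‖f i n‖ₑ * ‖e i n‖ₑ ≤ 1 := by
    have h2 : 2 * ∑ i, ‖f i n‖ₑ * ‖e i n‖ₑ ≤ 2 * 1 := by
      rw [Finset.mul_sum]
      calc ∑ i, 2 * (‖f i n‖ₑ * ‖e i n‖ₑ) ≤ ∑ i, (‖f i n‖ₑ ^ 2 + ‖e i n‖ₑ ^ 2) :=
            Finset.sum_le_sum fun n _ => two_mul_enorm_mul_le _ _
        _ ≤ 1 + 1 := by
            rw [Finset.sum_add_distrib]
            exact add_le_add (lp_two_orthonormal_sum_sq_le hf n) (lp_two_orthonormal_sum_sq_le he n)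
        _ = 2 * 1 := by norm_num
    rwa [ENNReal.mul_le_mul_iff_right (by norm_num) (by norm_num)] at h2
  rcases eq_or_ne r ∞ with rfl | hr'
  · rw [eLpNorm_exponent_top, eLpNormEssSup_count, ellNorm, if_pos rfl]
    refine iSup_le fun i => (enorm_inner_diagonal_le hD _ _).trans ?_
    calc ∑' n, ‖f i n‖ₑ * ‖e i n‖ₑ * ‖c n‖ₑ
        ≤ ∑' n, ‖f i n‖ₑ * ‖e i n‖ₑ * ⨆ n, ‖c n‖ₑ := by
          gcongr with n; exact le_iSup (fun n => ‖c n‖ₑ) n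
      _ ≤ 1 * ⨆ n, ‖c n‖ₑ := by rw [ENNReal.tsum_mul_right]; gcongr; exact hrow i
      _ = _ := one_mul _
  · have hr1 : 1 ≤ r.toReal := by
      rw [← ENNReal.toReal_one]; exact ENNReal.toReal_mono hr' hr
    have hr0 : 0 < r.toReal := by linarith
    rw [eLpNorm_eq_lintegral_rpow_enorm_toReal (by positivity) hr', lintegral_count, tsum_fintype,
      ellNorm, if_neg hr']
    gcongr
    have hpt (i : Fin N) : ‖⟪f i, D (e i)⟫‖ₑ ^ r.toReal ≤
        ∑' n, ‖f i n‖ₑ * ‖e i n‖ₑ * ‖c n‖ₑ ^ r.toReal := by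
      rw [← ENNReal.le_rpow_inv_iff hr0]
      refine (enorm_inner_diagonal_le hD _ _).trans ?_
      rw [ENNReal.tsum_eq_iSup_sum]
      refine iSup_le fun s => ?_
      refine (ENNReal.inner_le_weight_mul_Lp_of_nonneg s hr1 _ _).trans ?_
      calc _ ≤ (1 : ℝ≥0∞) ^ (1 - r.toReal⁻¹) *
            (∑' n, ‖f i n‖ₑ * ‖e i n‖ₑ * ‖c n‖ₑ ^ r.toReal) ^ r.toReal⁻¹ := by
            gcongr
            · exact sub_nonneg.2 (inv_le_one_of_one_le₀ hr1)
            · exact (ENNReal.sum_le_tsum s).trans (hrow i)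
            · exact ENNReal.sum_le_tsum s
        _ = _ := by rw [ENNReal.one_rpow, one_mul]
    calc ∑ i, ‖⟪f i, D (e i)⟫‖ₑ ^ r.toReal
        ≤ ∑ i, ∑' n, ‖f i n‖ₑ * ‖e i n‖ₑ * ‖c n‖ₑ ^ r.toReal := Finset.sum_le_sum fun i _ => hpt i
      _ = ∑' n, (∑ i, ‖f i n‖ₑ * ‖e i n‖ₑ) * ‖c n‖ₑ ^ r.toReal := by
          rw [← Summable.tsum_finsetSum (fun _ _ => ENNReal.summable)]
          simp only [Finset.sum_mul]
      _ ≤ ∑' n, 1 * ‖c n‖ₑ ^ r.toReal := by gcongr with n; exact hcol n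
      _ = ∑' n, ‖c n‖ₑ ^ r.toReal := by simp

theorem exists_diagonal_operator {c : ℕ → 𝕜} {K : ℝ} (hc : ∀ n, ‖c n‖ ≤ K) :
    ∃ D : lp (fun _ : ℕ => 𝕜) 2 →L[𝕜] lp (fun _ : ℕ => 𝕜) 2, ∀ x n, D x n = c n * x n := by
  refine ⟨lp.mapCLM 2 (fun n => c n • ContinuousLinearMap.id 𝕜 𝕜) (K := K)
    ((norm_nonneg _).trans (hc 0)) fun n => ?_, fun x n => ?_⟩
  · rw [norm_smul, ContinuousLinearMap.norm_id, mul_one]; exact hc n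
  · simp

/-- Splits exponents below `1` by writing a diagonal operator as a product of two square roots. -/
theorem TriangularBound.diagonal_of_one_le_pow (k : ℕ) {r : ℝ≥0∞} (hr : 1 ≤ 2 ^ k * r) {c : ℕ → 𝕜}
    {D : lp (fun _ : ℕ => 𝕜) 2 →L[𝕜] lp (fun _ : ℕ => 𝕜) 2} (hD : ∀ x n, D x n = c n * x n) :
    TriangularBound r (ellNorm r c) D := by
  induction k generalizing r c D with
  | zero => exact TriangularBound.diagonal_of_one_le (by simpa using hr) hD
  | succ k ih =>
    rcases eq_or_ne r ∞ with rfl | hr'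
    · exact TriangularBound.diagonal_of_one_le le_top hD
    have hr0 : r ≠ 0 := by rintro rfl; simp at hr
    have hc : ∀ n, ‖c n‖ ≤ ‖D‖ := by
      intro n
      have h1 := D.le_opNorm (lp.single 2 n (1 : 𝕜))
      have h2 := lp.norm_apply_le_norm (by norm_num) (D (lp.single 2 n (1 : 𝕜))) n
      rw [lp.norm_single (by norm_num), norm_one, mul_one] at h1
      rw [hD, lp.single_apply_self, mul_one] at h2
      exact h2.trans h1
    -- The phase of `c n` goes into `d'`; where `c n = 0`, division by zero gives `d' n = 0`, as
    -- required.
    let d : ℕ → 𝕜 := fun n => ((√‖c n‖ : ℝ) : 𝕜)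
    let d' : ℕ → 𝕜 := fun n => c n / ((√‖c n‖ : ℝ) : 𝕜)
    have hd n : ‖d n‖ = √‖c n‖ := by
      simp only [d]; rw [RCLike.norm_ofReal, abs_of_nonneg (Real.sqrt_nonneg _)]
    have hd' n : ‖d' n‖ = √‖c n‖ := by
      simp only [d']
      rw [norm_div, RCLike.norm_ofReal, abs_of_nonneg (Real.sqrt_nonneg _), Real.div_sqrt]
    have hdd n : d' n * d n = c n := by
      by_cases h : c n = 0
      · simp [d, d', h]
      · have : ((√‖c n‖ : ℝ) : 𝕜) ≠ 0 := by
          rw [RCLike.ofReal_ne_zero]; exact (Real.sqrt_pos.2 (norm_pos_iff.2 h)).ne'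
        simp only [d, d']; field_simp
    obtain ⟨A, hA⟩ := exists_diagonal_operator (c := d) (K := √‖D‖)
      fun n => (hd n).trans_le (Real.sqrt_le_sqrt (hc n))
    obtain ⟨B, hB⟩ := exists_diagonal_operator (c := d') (K := √‖D‖)
      fun n => (hd' n).trans_le (Real.sqrt_le_sqrt (hc n))
    have hBA : D = B ∘L A := by
      ext x n
      rw [ContinuousLinearMap.comp_apply, hB, hA, hD, ← hdd, mul_assoc]
    have hk : 1 ≤ 2 ^ k * (2 * r) := by rwa [← mul_assoc, ← pow_succ]
    have hsqrt {b : ℕ → 𝕜} (hb : ∀ n, ‖b n‖ = √‖c n‖) :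
        ellNorm (2 * r) b = ellNorm r c ^ (1 / 2 : ℝ) := by
      have hb' n : ‖b n‖ₑ = ‖c n‖ₑ ^ (1 / 2 : ℝ) := by
        rw [← ofReal_norm, hb, Real.sqrt_eq_rpow, ← ofReal_norm (c n),
          ENNReal.ofReal_rpow_of_nonneg (norm_nonneg _) (by norm_num)]
      rw [ellNorm, if_neg (ENNReal.mul_ne_top (by norm_num) hr'), ellNorm, if_neg hr']
      simp only [hb', ← ENNReal.rpow_mul, ENNReal.toReal_mul, ENNReal.toReal_ofNat]
      congr 1
      · congr 1; funext n; congr 1; ring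
      · ring
    have h := (ih hk hB).comp (ih hk hA) (r := r) (by
      rw [ENNReal.mul_inv (by simp) (by simp), ← two_mul, ← mul_assoc,
        ENNReal.mul_inv_cancel (by norm_num) (by norm_num), one_mul])
    rw [hsqrt hd, hsqrt hd', ← ENNReal.rpow_add_of_nonneg _ _ (by norm_num) (by norm_num),
      add_halves, ENNReal.rpow_one, ← hBA] at h
    exact h

theorem TriangularBound.diagonal {r : ℝ≥0∞} (hr : 0 < r) {c : ℕ → 𝕜}
    {D : lp (fun _ : ℕ => 𝕜) 2 →L[𝕜] lp (fun _ : ℕ => 𝕜) 2} (hD : ∀ x n, D x n = c n * x n) :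
    TriangularBound r (ellNorm r c) D := by
  obtain ⟨k, hk⟩ : ∃ k : ℕ, r⁻¹ ≤ 2 ^ k := by
    obtain ⟨k, hk⟩ := ENNReal.exists_nat_gt (ENNReal.inv_ne_top.2 hr.ne')
    refine ⟨k, hk.le.trans ?_⟩
    exact_mod_cast k.lt_two_pow_self.le
  refine TriangularBound.diagonal_of_one_le_pow k ?_ hD
  rcases eq_or_ne r ∞ with rfl | hr'
  · simp
  · rw [← ENNReal.inv_mul_cancel hr.ne' hr']
    gcongr

/-- Hilbert-Schmidt operators given by their rows. -/
theorem TriangularBound.of_rows {E : Type*} [NormedAddCommGroup E]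
    [InnerProductSpace 𝕜 E] [CompleteSpace E] {b : ℕ → 𝕜} {φ : ℕ → StrongDual 𝕜 E}
    (hφ : ∀ n, ‖φ n‖ ≤ 1) {U : E →L[𝕜] lp (fun _ : ℕ => 𝕜) 2} (hU : ∀ x n, U x n = b n * φ n x) :
    TriangularBound 2 (ellNorm 2 b) U := by
  intro N e f he hf _ _
  rw [eLpNorm_count_fin_two, ellNorm, if_neg (by norm_num), ENNReal.toReal_ofNat]
  gcongr
  -- Exchanging the sums over `i` and `n` lets Bessel's inequality be used for each functional `φ n`
  -- separately.
  calc ∑ i, ‖⟪f i, U (e i)⟫‖ₑ ^ 2 ≤ ∑ i, ‖U (e i)‖ₑ ^ 2 := by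
        gcongr with i
        rw [← ofReal_norm, ← ofReal_norm]
        refine ENNReal.ofReal_le_ofReal ((norm_inner_le_norm _ _).trans ?_)
        rw [hf.1, one_mul]
    _ = ∑' n, ‖b n‖ₑ ^ 2 * ∑ i, ‖φ n (e i)‖ₑ ^ 2 := by
        simp only [lp_two_enorm_sq, hU, enorm_mul, mul_pow, Finset.mul_sum]
        rw [← Summable.tsum_finsetSum (fun _ _ => ENNReal.summable)]
    _ ≤ ∑' n, ‖b n‖ₑ ^ 2 * 1 := by
        gcongr with n
        refine (he.sum_enorm_dual_sq_le (φ n)).trans ?_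
        rw [← ofReal_norm]
        exact pow_le_one₀ zero_le (ENNReal.ofReal_le_one.2 (hφ n))
    _ = ∑' n, ‖b n‖ₑ ^ (2 : ℝ) := by simp

end SequenceSpace

/-! ### Factorization of nuclear operators and of their products through `ℓ_2`. -/

section NuclearFactorization

variable {𝕜 : Type*} [RCLike 𝕜]
variable {X : Type*} [NormedAddCommGroup X] [NormedSpace 𝕜 X]
variable {Y : Type*} [NormedAddCommGroup Y] [NormedSpace 𝕜 Y]

theorem ellNorm_two {E : Type*} [ENorm E] (a : ℕ → E) :
    ellNorm 2 a = (∑' n, ‖a n‖ₑ ^ 2) ^ (1 / 2 : ℝ) := by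
  rw [ellNorm, if_neg (by norm_num)]
  simp

theorem exists_rows_operator {b : ℕ → 𝕜} (hb : ellNorm 2 b < ∞) {φ : ℕ → StrongDual 𝕜 X}
    (hφ : ∀ n, ‖φ n‖ ≤ 1) :
    ∃ A : X →L[𝕜] lp (fun _ : ℕ => 𝕜) 2, (∀ x n, A x n = b n * φ n x) ∧ ‖A‖ₑ ≤ ellNorm 2 b := by
  have hle (x : X) : ∑' n, ‖b n * φ n x‖ₑ ^ 2 ≤ (ellNorm 2 b * ‖x‖ₑ) ^ 2 := by
    rw [ellNorm_two, mul_pow, ← ENNReal.rpow_natCast, ← ENNReal.rpow_mul]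
    norm_num
    rw [← ENNReal.tsum_mul_right]
    gcongr with n
    rw [mul_pow]
    gcongr
    rw [← ofReal_norm, ← ofReal_norm]
    refine ENNReal.ofReal_le_ofReal (((φ n).le_opNorm x).trans ?_)
    exact mul_le_of_le_one_left (norm_nonneg _) (hφ n)
  have hmem (x : X) : Memℓp (fun n => b n * φ n x) 2 :=
    memℓp_two_of_tsum_ne_top
      ((hle x).trans_lt (ENNReal.pow_lt_top (ENNReal.mul_lt_top hb enorm_lt_top))).ne
  let L : X →ₗ[𝕜] lp (fun _ : ℕ => 𝕜) 2 :=
    { toFun := fun x => ⟨fun n => b n * φ n x, hmem x⟩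
      map_add' := fun x y => by ext n; simp only [map_add, mul_add]; rfl
      map_smul' := fun c x => by ext n; simp [mul_left_comm] }
  have hL (x : X) : ‖L x‖ₑ ≤ ellNorm 2 b * ‖x‖ₑ := by
    rw [← ENNReal.pow_le_pow_left_iff two_ne_zero, lp_two_enorm_sq]
    exact hle x
  have hL' (x : X) : ‖L x‖ ≤ (ellNorm 2 b).toReal * ‖x‖ := by
    have := ENNReal.toReal_mono (ENNReal.mul_lt_top hb enorm_lt_top).ne (hL x)
    simpa using this
  refine ⟨L.mkContinuous _ hL', fun x n => rfl, ?_⟩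
  rw [← ofReal_norm]
  exact ENNReal.ofReal_le_of_le_toReal (L.mkContinuous_norm_le ENNReal.toReal_nonneg hL')

/-- A norming functional of the sum reduces this to the scalar Cauchy-Schwarz inequality. As a bound
on finite sums it yields both the convergence and the contractivity in `exists_synthesis_operator`.
-/
theorem norm_sum_smul_sq_le {y : ℕ → Y} (hy : weakTwoNorm 𝕜 y ≤ 1) (x : ℕ → 𝕜) (t : Finset ℕ) :
    ‖∑ n ∈ t, x n • y n‖ ^ 2 ≤ ∑ n ∈ t, ‖x n‖ ^ 2 := by
  obtain ⟨g, hg, hgx⟩ := exists_dual_vector'' 𝕜 (∑ n ∈ t, x n • y n)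
  have h1 : ∑ n ∈ t, ‖g (y n)‖ ^ 2 ≤ 1 := by
    have h : ellNorm 2 (fun n => g (y n)) ≤ 1 :=
      (le_iSup₂ (f := fun (y' : StrongDual 𝕜 Y) (_ : ‖y'‖ ≤ 1) => ellNorm 2 fun n => y' (y n))
        g hg).trans hy
    rw [ellNorm_two, ← ENNReal.one_rpow (1 / 2 : ℝ), ENNReal.rpow_le_rpow_iff (by norm_num)] at h
    have h2 := (ENNReal.sum_le_tsum t).trans h
    simp only [← ofReal_norm, ← ENNReal.ofReal_pow (norm_nonneg _)] at h2
    rwa [← ENNReal.ofReal_sum_of_nonneg (fun i _ => sq_nonneg _), ENNReal.ofReal_le_one] at h2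
  have h3 : ‖∑ n ∈ t, x n • y n‖ ≤ ∑ n ∈ t, ‖x n‖ * ‖g (y n)‖ := by
    have : ‖g (∑ n ∈ t, x n • y n)‖ = ‖∑ n ∈ t, x n • y n‖ := by rw [hgx]; simp
    rw [← this, map_sum]
    refine (norm_sum_le _ _).trans (le_of_eq ?_)
    simp
  calc ‖∑ n ∈ t, x n • y n‖ ^ 2 ≤ (∑ n ∈ t, ‖x n‖ * ‖g (y n)‖) ^ 2 := by gcongr
    _ ≤ (∑ n ∈ t, ‖x n‖ ^ 2) * ∑ n ∈ t, ‖g (y n)‖ ^ 2 := Finset.sum_mul_sq_le_sq_mul_sq _ _ _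
    _ ≤ (∑ n ∈ t, ‖x n‖ ^ 2) * 1 := by gcongr
    _ = _ := mul_one _

theorem exists_synthesis_operator [CompleteSpace Y] {y : ℕ → Y} (hy : weakTwoNorm 𝕜 y ≤ 1) :
    ∃ B : lp (fun _ : ℕ => 𝕜) 2 →L[𝕜] Y, ‖B‖ ≤ 1 ∧ ∀ x, HasSum (fun n => x n • y n) (B x) := by
  have hsq (x : lp (fun _ : ℕ => 𝕜) 2) : HasSum (fun n => ‖x n‖ ^ 2) (‖x‖ ^ 2) := by
    have h := lp.hasSum_norm (p := 2) (by simp) x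
    simpa only [ENNReal.toReal_ofNat, Real.rpow_ofNat] using h
  have hsum (x : lp (fun _ : ℕ => 𝕜) 2) : Summable (fun n => x n • y n) := by
    rw [summable_iff_vanishing_norm]
    intro ε hε
    obtain ⟨s, hs⟩ := summable_iff_vanishing_norm.1 (hsq x).summable (ε ^ 2) (by positivity)
    refine ⟨s, fun t ht => ?_⟩
    refine lt_of_pow_lt_pow_left₀ 2 hε.le ((norm_sum_smul_sq_le hy _ t).trans_lt ?_)
    exact (le_abs_self _).trans_lt (hs t ht)
  let L : lp (fun _ : ℕ => 𝕜) 2 →ₗ[𝕜] Y :=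
    { toFun := fun x => ∑' n, x n • y n
      map_add' := fun x z => by
        rw [← (hsum x).tsum_add (hsum z)]
        simp [add_smul]
      map_smul' := fun c x => by
        rw [RingHom.id_apply, ← (hsum x).tsum_const_smul c]
        simp [mul_smul] }
  have hL (x : lp (fun _ : ℕ => 𝕜) 2) : ‖L x‖ ≤ 1 * ‖x‖ := by
    rw [one_mul]
    refine le_of_tendsto (hsum x).hasSum.norm (Filter.Eventually.of_forall fun t => ?_)
    refine le_of_sq_le_sq ((norm_sum_smul_sq_le hy _ t).trans ?_) (norm_nonneg _)
    exact sum_le_hasSum t (fun _ _ => sq_nonneg _) (hsq x)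
  exact ⟨L.mkContinuous 1 hL, L.mkContinuous_norm_le zero_le_one hL, fun x => (hsum x).hasSum⟩

/-- `T` factors as `B D A` through `ℓ_2`, where `B` is a contraction, `D` has a triangular bound of
order `1/r = 1/s - 1/2` and `A` becomes Hilbert-Schmidt when it is preceded by an operator on a
Hilbert space; the product of the norms is at most `κ`. -/
def HasTriangularFactorization (s κ : ℝ≥0∞) (T : X →L[𝕜] Y) : Prop :=
  ∃ (r α β : ℝ≥0∞) (A : X →L[𝕜] lp (fun _ : ℕ => 𝕜) 2)
    (D : lp (fun _ : ℕ => 𝕜) 2 →L[𝕜] lp (fun _ : ℕ => 𝕜) 2) (B : lp (fun _ : ℕ => 𝕜) 2 →L[𝕜] Y),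
    r⁻¹ + 2⁻¹ = s⁻¹ ∧ T = B ∘L D ∘L A ∧ ‖B‖ ≤ 1 ∧ TriangularBound r β D ∧ ‖A‖ₑ ≤ α ∧
      (∀ B' : lp (fun _ : ℕ => 𝕜) 2 →L[𝕜] X, ‖B'‖ ≤ 1 → TriangularBound 2 α (A ∘L B')) ∧
      β * α ≤ κ

/-- A sequence in `ℓ_s` is the product of a sequence in `ℓ_r` and one in `ℓ_2`. -/
theorem exists_ellNorm_splitting {s r : ℝ≥0∞} (hs : 0 < s) (hr : r⁻¹ + 2⁻¹ = s⁻¹) (a : ℕ → 𝕜)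
    (ha : ellNorm s a < ∞) :
    ∃ c b : ℕ → 𝕜, (∀ n, c n * b n = a n) ∧ (∃ K, ∀ n, ‖c n‖ ≤ K) ∧ ellNorm 2 b < ∞ ∧
      ellNorm r c * ellNorm 2 b = ellNorm s a := by
  have hs' : s ≠ ∞ := by rintro rfl; simp at hr
  have hr0 : r ≠ 0 := by
    rintro rfl
    rw [ENNReal.inv_zero, top_add, eq_comm, ENNReal.inv_eq_top] at hr
    exact hs.ne' hr
  have hs0 : 0 < s.toReal := ENNReal.toReal_pos hs.ne' hs'
  have hrs : r.toReal⁻¹ + 2⁻¹ = s.toReal⁻¹ := by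
    have := congrArg ENNReal.toReal hr
    rwa [ENNReal.toReal_add (ENNReal.inv_ne_top.2 hr0) (by simp), ENNReal.toReal_inv,
      ENNReal.toReal_inv, ENNReal.toReal_inv, ENNReal.toReal_ofNat] at this
  set σ := s.toReal with hσ
  have hθ : 1 - σ / 2 = σ * r.toReal⁻¹ := by
    rw [eq_sub_of_add_eq hrs, mul_sub, mul_inv_cancel₀ hs0.ne']; ring
  have hθ0 : 0 ≤ 1 - σ / 2 := by rw [hθ]; positivity
  set S := ∑' n, ‖a n‖ₑ ^ σ with hS
  have haS : ellNorm s a = S ^ (1 / σ) := by rw [ellNorm, if_neg hs']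
  -- The moduli are `|c| = |a|^{s/r}` and `|b| = |a|^{s/2}`, with the phase in `b`. For `s = 2`, `r
  -- = ∞`, this is `c = 1`, by `0^0 = 1`.
  let c : ℕ → 𝕜 := fun n => ((‖a n‖ ^ (1 - σ / 2) : ℝ) : 𝕜)
  let b : ℕ → 𝕜 := fun n => a n * ((‖a n‖ ^ (-(1 - σ / 2)) : ℝ) : 𝕜)
  have hcn n : ‖c n‖ = ‖a n‖ ^ (1 - σ / 2) := by
    simp only [c]; rw [RCLike.norm_ofReal, abs_of_nonneg (by positivity)]
  have hbn n : ‖b n‖ = ‖a n‖ ^ (σ / 2) := by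
    simp only [b]
    rw [norm_mul, RCLike.norm_ofReal, abs_of_nonneg (by positivity)]
    rcases (norm_nonneg (a n)).eq_or_lt with h | h
    · rw [← h, zero_mul, Real.zero_rpow (by positivity)]
    · rw [← Real.rpow_one_add' h.le]
      · congr 1; ring
      · linarith
  have hce n : ‖c n‖ₑ = ‖a n‖ₑ ^ (1 - σ / 2) := by
    rw [← ofReal_norm, hcn, ← ofReal_norm (a n), ENNReal.ofReal_rpow_of_nonneg (norm_nonneg _) hθ0]
  have hbe n : ‖b n‖ₑ = ‖a n‖ₑ ^ (σ / 2) := by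
    rw [← ofReal_norm, hbn, ← ofReal_norm (a n),
      ENNReal.ofReal_rpow_of_nonneg (norm_nonneg _) (by positivity)]
  have hb2 : ellNorm 2 b = S ^ (1 / 2 : ℝ) := by
    rw [ellNorm_two]
    simp only [hbe, ← ENNReal.rpow_natCast, ← ENNReal.rpow_mul, hS]
    congr 3; funext n; congr 1; push_cast; ring
  have hcr : ellNorm r c = S ^ (r.toReal⁻¹) := by
    rcases eq_or_ne r ∞ with rfl | hr'
    · rw [ellNorm, if_pos rfl]
      simp only [hce, hθ]
      simp
    · rw [ellNorm, if_neg hr', one_div]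
      have : r.toReal ≠ 0 := (ENNReal.toReal_pos hr0 hr').ne'
      simp only [hce, hθ, ← ENNReal.rpow_mul, hS]
      congr 3; funext n; congr 1; field_simp
  have hS' : S < ∞ := by
    rw [haS] at ha
    by_contra h
    rw [not_lt_top_iff.1 h, ENNReal.top_rpow_of_pos (by positivity)] at ha
    exact lt_irrefl _ ha
  refine ⟨c, b, fun n => ?_, ⟨(ellNorm s a).toReal ^ (1 - σ / 2), fun n => ?_⟩, ?_, ?_⟩
  · simp only [c, b]
    rcases (norm_nonneg (a n)).eq_or_lt with h | h
    · rw [norm_eq_zero.1 h.symm]; simp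
    · rw [mul_left_comm, ← RCLike.ofReal_mul, ← Real.rpow_add h]; simp
  · rw [hcn]
    gcongr
    have h1 : ‖a n‖ₑ ≤ ellNorm s a := by
      rw [haS, one_div, ENNReal.le_rpow_inv_iff hs0]
      exact ENNReal.le_tsum n
    simpa using ENNReal.toReal_mono ha.ne h1
  · rw [hb2]; exact ENNReal.rpow_lt_top_of_nonneg (by norm_num) hS'.ne
  · rw [hb2, hcr, ← ENNReal.rpow_add_of_nonneg _ _ (by positivity) (by norm_num), haS, one_div,
      one_div, hrs]

theorem Represents.hasTriangularFactorization [CompleteSpace Y] {s : ℝ≥0∞} (hs : 0 < s)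
    (hs2 : s ≤ 2) {T : X →L[𝕜] Y} {a : ℕ → 𝕜} {x' : ℕ → StrongDual 𝕜 X} {y : ℕ → Y}
    (h : Represents T a x' y) (hy : weakTwoNorm 𝕜 y ≤ 1) (ha : ellNorm s a < ∞) :
    HasTriangularFactorization s (ellNorm s a) T := by
  obtain ⟨r, hr⟩ : ∃ r : ℝ≥0∞, r⁻¹ + 2⁻¹ = s⁻¹ :=
    ⟨(s⁻¹ - 2⁻¹)⁻¹, by rw [inv_inv, tsub_add_cancel_of_le (ENNReal.inv_le_inv.2 hs2)]⟩
  have hr0 : 0 < r := by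
    rw [pos_iff_ne_zero]
    rintro rfl
    rw [ENNReal.inv_zero, top_add, eq_comm, ENNReal.inv_eq_top] at hr
    exact hs.ne' hr
  obtain ⟨c, b, hcb, ⟨K, hK⟩, hb, hκ⟩ := exists_ellNorm_splitting hs hr a ha
  obtain ⟨D, hD⟩ := exists_diagonal_operator hK
  obtain ⟨A, hA, hAn⟩ := exists_rows_operator hb h.1
  obtain ⟨B, hB, hBs⟩ := exists_synthesis_operator hy
  refine ⟨r, ellNorm 2 b, ellNorm r c, A, D, B, hr, ?_, hB, .diagonal hr0 hD, hAn,
    fun B' hB' => ?_, hκ.le⟩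
  · ext x
    refine (h.2 x).unique ?_
    have h1 := hBs (D (A x))
    simp only [hD, hA, ← mul_assoc, hcb, mul_smul] at h1
    exact h1
  · refine TriangularBound.of_rows (φ := fun n => (x' n) ∘L B') (fun n => ?_) fun x n => ?_
    · exact (ContinuousLinearMap.opNorm_comp_le _ _).trans
        (mul_le_one₀ (h.1 n) (norm_nonneg _) hB')
    · rw [ContinuousLinearMap.comp_apply, hA, ContinuousLinearMap.comp_apply]

/-- A new operator `B' D A'` meets the earlier chain `B U A` in `A' B`, which has a triangular bound
of order `2`, so the new middle part is `D (A' B) U`. Only the first analysis map, which starts in a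
Banach space, is estimated by its operator norm. -/
theorem chainProd_hasTriangularFactorization {m : ℕ} (hm : m ≠ 0) (X : Fin (m + 1) → Type u)
    [∀ i, NormedAddCommGroup (X i)] [∀ i, NormedSpace 𝕜 (X i)] (s κ : Fin m → ℝ≥0∞)
    (T : ∀ k : Fin m, X k.castSucc →L[𝕜] X k.succ)
    (hT : ∀ k, HasTriangularFactorization (s k) (κ k) (T k)) :
    ∃ (p M : ℝ≥0∞) (A : X 0 →L[𝕜] lp (fun _ : ℕ => 𝕜) 2)
      (U : lp (fun _ : ℕ => 𝕜) 2 →L[𝕜] lp (fun _ : ℕ => 𝕜) 2)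
      (B : lp (fun _ : ℕ => 𝕜) 2 →L[𝕜] X (Fin.last m)),
      p⁻¹ + 2⁻¹ = ∑ k, (s k)⁻¹ ∧ chainProd X T = B ∘L U ∘L A ∧ ‖B‖ ≤ 1 ∧
      TriangularBound p M U ∧ M * ‖A‖ₑ ≤ ∏ k, κ k := by
  induction m with
  | zero => exact absurd rfl hm
  | succ m ih =>
    obtain ⟨r, α, β, A', D, B', hr, hT', hB', hD, hA', hAB, hκ⟩ := hT (Fin.last m)
    rcases Nat.eq_zero_or_pos m with rfl | hm'
    · refine ⟨r, β, A', D, B', ?_, ?_, hB', hD, ?_⟩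
      · rw [hr, Fin.sum_univ_one]; rfl
      · rw [← hT']; rfl
      · rw [Fin.prod_univ_one]
        exact le_trans (by gcongr) hκ
    · obtain ⟨p, M, A, U, B, hp, hch, hB, hU, hM⟩ := ih hm'.ne' (fun i => X i.castSucc)
        (fun k => s k.castSucc) (fun k => κ k.castSucc) (fun k => T k.castSucc)
        (fun k => hT k.castSucc)
      refine ⟨(r⁻¹ + (2⁻¹ + p⁻¹))⁻¹, β * (α * M), A, D ∘L (A' ∘L B) ∘L U, B', ?_, ?_, hB', ?_, ?_⟩
      · rw [Fin.sum_univ_castSucc, ← hp, ← hr, inv_inv]; ring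
      · rw [chainProd, hch, hT']; rfl
      · exact hD.comp ((hAB B hB).comp hU (inv_inv _).symm) (by rw [inv_inv, inv_inv])
      · rw [Fin.prod_univ_castSucc]
        calc β * (α * M) * ‖A‖ₑ = (M * ‖A‖ₑ) * (β * α) := by ring
          _ ≤ _ := by gcongr

end NuclearFactorization

/-! ### Compression to minimal dimension and singular numbers. -/

section FiniteRank

open MeasureTheory Module

variable {𝕜 : Type*} [RCLike 𝕜]

local notation "⟪" x ", " y "⟫" => inner 𝕜 x y

/-- Singular value decomposition of a surjection onto a finite-dimensional space. -/
theorem exists_singular_value_decomposition {E F : Type*} [NormedAddCommGroup E]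
    [InnerProductSpace 𝕜 E] [CompleteSpace E] [NormedAddCommGroup F] [InnerProductSpace 𝕜 F]
    [FiniteDimensional 𝕜 F] {N : ℕ} (hN : finrank 𝕜 F = N) (R : E →L[𝕜] F)
    (hR : Function.Surjective R) :
    ∃ (σ : Fin N → ℝ) (v : Fin N → E) (w : OrthonormalBasis (Fin N) 𝕜 F),
      Antitone σ ∧ (∀ i, 0 < σ i) ∧ Orthonormal 𝕜 v ∧ ∀ i x, ⟪w i, R x⟫ = σ i * ⟪v i, x⟫ := by
  have : CompleteSpace F := FiniteDimensional.complete 𝕜 F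
  let R' : F →L[𝕜] E := ContinuousLinearMap.adjoint R
  have hR' (y : F) (x : E) : ⟪R' y, x⟫ = ⟪y, R x⟫ := ContinuousLinearMap.adjoint_inner_left R x y
  -- Diagonalizing `R R*` on the finite-dimensional side avoids spectral theory on `E`. With
  -- eigenvectors `w i` and eigenvalues `μ i`, the other system is `R* (w i) / √(μ i)`; surjectivity
  -- of `R` makes every `μ i` positive.
  let S : F →ₗ[𝕜] F := (R ∘L R' : F →L[𝕜] F)
  have hS : S.IsSymmetric := by
    intro x y
    change ⟪R (R' x), y⟫ = ⟪x, R (R' y)⟫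
    rw [← hR', ← inner_conj_symm, ← hR', inner_conj_symm]
  let w := hS.eigenvectorBasis hN
  let μ := hS.eigenvalues hN
  have hSw i : R (R' (w i)) = (μ i : 𝕜) • w i := hS.apply_eigenvectorBasis hN i
  have hinner i j : ⟪R' (w i), R' (w j)⟫ = if i = j then (μ i : 𝕜) else 0 := by
    rw [hR', hSw, inner_smul_right, orthonormal_iff_ite.1 w.orthonormal]
    split_ifs with h
    · rw [h, mul_one]
    · rw [mul_zero]
  have hne i : R' (w i) ≠ 0 := by
    intro h0
    obtain ⟨x, hx⟩ := hR (w i)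
    have h1 : ⟪w i, w i⟫ = 0 := by
      nth_rw 2 [← hx]
      rw [← hR', h0, inner_zero_left]
    exact w.orthonormal.ne_zero i (inner_self_eq_zero.1 h1)
  have hμ i : 0 < μ i := by
    have h1 : ((‖R' (w i)‖ ^ 2 : ℝ) : 𝕜) = (μ i : 𝕜) := by
      have := hinner i i
      rw [if_pos rfl, inner_self_eq_norm_sq_to_K] at this
      exact_mod_cast this
    rw [← RCLike.ofReal_inj.1 h1]
    have := norm_pos_iff.2 (hne i)
    positivity
  have hσ i : 0 < √(μ i) := Real.sqrt_pos.2 (hμ i)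
  have hσ' i : ((√(μ i) : ℝ) : 𝕜) ≠ 0 := RCLike.ofReal_ne_zero.2 (hσ i).ne'
  refine ⟨fun i => √(μ i), fun i => ((√(μ i) : ℝ) : 𝕜)⁻¹ • R' (w i), w,
    fun i j hij => Real.sqrt_le_sqrt (hS.eigenvalues_antitone hN hij), hσ, ?_, fun i x => ?_⟩
  · rw [orthonormal_iff_ite]
    intro i j
    rw [inner_smul_left, inner_smul_right, hinner]
    split_ifs with h
    · subst h
      rw [map_inv₀, RCLike.conj_ofReal, ← mul_assoc, ← mul_inv, ← RCLike.ofReal_mul,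
        Real.mul_self_sqrt (hμ i).le, inv_mul_cancel₀ (RCLike.ofReal_ne_zero.2 (hμ i).ne')]
    · simp
  · rw [inner_smul_left, map_inv₀, RCLike.conj_ofReal, ← mul_assoc, mul_inv_cancel₀ (hσ' i),
      one_mul, hR']

theorem LinearEquiv.exists_linearIsometryEquiv {G V : Type*} [AddCommGroup G] [Module 𝕜 G]
    [NormedAddCommGroup V] [InnerProductSpace 𝕜 V] (e : G ≃ₗ[𝕜] V) :
    ∃ (_ : NormedAddCommGroup G) (_ : InnerProductSpace 𝕜 G), Nonempty (G ≃ₗᵢ[𝕜] V) := by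
  let i1 : NormedAddCommGroup G := NormedAddCommGroup.induced G V e e.injective
  let i2 : InnerProductSpace 𝕜 G := InnerProductSpace.induced e
  exact ⟨i1, i2, ⟨{ e with norm_map' := fun _ => rfl }⟩⟩

/-- Every universe contains Hilbert spaces of all finite dimensions. -/
theorem exists_orthonormalBasis_fin (𝕜 : Type*) [RCLike 𝕜] (N : ℕ) :
    ∃ (H : Type w) (_ : NormedAddCommGroup H) (_ : InnerProductSpace 𝕜 H),
      Nonempty (OrthonormalBasis (Fin N) 𝕜 H) := by
  let V := EuclideanSpace 𝕜 (Fin N)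
  -- The field embeds in `ℝ × ℝ`, so the Euclidean space has a copy in any universe, to which the
  -- inner product is transported.
  have : Small.{w} 𝕜 := small_of_injective (f := fun z : 𝕜 => (RCLike.re z, RCLike.im z))
    fun z z' h => RCLike.ext (congrArg Prod.fst h) (congrArg Prod.snd h)
  have : Small.{w} V := small_of_injective (f := fun x : V => (x : Fin N → 𝕜))
    fun x y h => PiLp.ext (congrFun h)
  obtain ⟨G, _, _, ⟨e⟩⟩ : ∃ (G : Type w) (_ : AddCommGroup G) (_ : Module 𝕜 G),
      Nonempty (G ≃ₗ[𝕜] V) := ⟨Shrink.{w} V, _, _, ⟨Shrink.linearEquiv 𝕜 V⟩⟩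
  obtain ⟨i1, i2, ⟨e⟩⟩ := e.exists_linearIsometryEquiv
  exact ⟨G, i1, i2, ⟨(EuclideanSpace.basisFun (Fin N) 𝕜).map e.symm⟩⟩

theorem OrthonormalBasis.inner_diagonal {H : Type*} [NormedAddCommGroup H] [InnerProductSpace 𝕜 H]
    {N : ℕ} (h : OrthonormalBasis (Fin N) 𝕜 H) {σ : Fin N → ℝ} {U : H →L[𝕜] H}
    (hU : ∀ i, U (h i) = (σ i : 𝕜) • h i) (i : Fin N) (x : H) : ⟪h i, U x⟫ = σ i * ⟪h i, x⟫ := by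
  conv_lhs => rw [← h.sum_repr' x]
  simp only [map_sum, map_smul, hU, inner_sum, inner_smul_right,
    orthonormal_iff_ite.1 h.orthonormal]
  simp [mul_comm]

theorem singularNumber_nonneg {H : Type*} [NormedAddCommGroup H] [InnerProductSpace 𝕜 H]
    [CompleteSpace H] (U : H →L[𝕜] H) (n : ℕ) : 0 ≤ singularNumber U n :=
  Real.sSup_nonneg fun _ h => h.1.le

/-- An eigenvector of `U* U` for `s²` with `s ≥ τ > 0` only involves basis vectors with `σ i = s`.
So the spectral subspace has dimension at most the number of `i` with `σ i ≥ τ`; if that exceeds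
`n`, some such `i` is at least `n`, and monotonicity gives `τ ≤ σ n`. -/
theorem singularNumber_diagonal_le {H : Type*} [NormedAddCommGroup H] [InnerProductSpace 𝕜 H]
    [CompleteSpace H] {N : ℕ} (h : OrthonormalBasis (Fin N) 𝕜 H) {σ : Fin N → ℝ} (hσ : Antitone σ)
    (hσ0 : ∀ i, 0 < σ i) {U : H →L[𝕜] H} (hU : ∀ i, U (h i) = (σ i : 𝕜) • h i) (n : ℕ) :
    singularNumber U n ≤ if hn : n < N then σ ⟨n, hn⟩ else 0 := by
  have hUU (i : Fin N) (x : H) :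
      ⟪h i, (ContinuousLinearMap.adjoint U ∘L U : H →L[𝕜] H) x⟫ = (σ i : 𝕜) ^ 2 * ⟪h i, x⟫ := by
    rw [ContinuousLinearMap.comp_apply, ContinuousLinearMap.adjoint_inner_right, hU,
      inner_smul_left, h.inner_diagonal hU, RCLike.conj_ofReal]
    ring
  have hcard {τ : ℝ} (hτ : 0 < τ) (hτn : n < finrank 𝕜
      (⨆ (s : ℝ) (_ : τ ≤ s), Module.End.eigenspace
        ((ContinuousLinearMap.adjoint U ∘L U : H →L[𝕜] H) : H →ₗ[𝕜] H) ((s ^ 2 : ℝ) : 𝕜) :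
          Submodule 𝕜 H)) : ∃ i : Fin N, n ≤ i ∧ τ ≤ σ i := by
    classical
    let I : Finset (Fin N) := {i | τ ≤ σ i}
    have hle : (⨆ (s : ℝ) (_ : τ ≤ s), Module.End.eigenspace
        ((ContinuousLinearMap.adjoint U ∘L U : H →L[𝕜] H) : H →ₗ[𝕜] H) ((s ^ 2 : ℝ) : 𝕜) :
          Submodule 𝕜 H) ≤ Submodule.span 𝕜 (I.image h : Finset H) := by
      refine iSup₂_le fun s hs x hx => ?_
      rw [Module.End.mem_eigenspace_iff] at hx
      rw [← h.sum_repr' x]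
      refine Submodule.sum_mem _ fun i _ => ?_
      by_cases hi : ⟪h i, x⟫ = 0
      · rw [hi, zero_smul]; exact Submodule.zero_mem _
      · refine Submodule.smul_mem _ _ (Submodule.subset_span ?_)
        have h1 := hUU i x
        rw [show (ContinuousLinearMap.adjoint U ∘L U : H →L[𝕜] H) x = ((s ^ 2 : ℝ) : 𝕜) • x from hx,
          inner_smul_right] at h1
        have h2 : s ^ 2 = σ i ^ 2 := by
          have := mul_right_cancel₀ hi h1
          exact_mod_cast this
        have h3 : s = σ i := (sq_eq_sq₀ (hτ.le.trans hs) (hσ0 i).le).1 h2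
        exact Finset.mem_coe.2 (Finset.mem_image_of_mem h (by simpa [I, ← h3] using hs))
    have hI : n < I.card := by
      refine hτn.trans_le ((Submodule.finrank_mono hle).trans ?_)
      exact (finrank_span_finset_le_card _).trans Finset.card_image_le
    by_contra! hcon
    have hsub : I.image (fun i : Fin N => (i : ℕ)) ⊆ Finset.range n := by
      intro j hj
      obtain ⟨i, hi, rfl⟩ := Finset.mem_image.1 hj
      rw [Finset.mem_range]
      by_contra hni
      exact absurd (by simpa [I] using hi) (not_le.2 (hcon i (not_lt.1 hni)))
    have := Finset.card_le_card hsub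
    rw [Finset.card_image_of_injective _ Fin.val_injective, Finset.card_range] at this
    omega
  refine Real.sSup_le (fun τ hτ => ?_) ?_
  · obtain ⟨i, hni, hi⟩ := hcard hτ.1 hτ.2
    rw [dif_pos (hni.trans_lt i.2)]
    exact hi.trans (hσ (Fin.le_def.2 hni))
  · split_ifs
    · exact (hσ0 _).le
    · exact le_rfl

theorem schattenNorm_diagonal_le {H : Type*} [NormedAddCommGroup H] [InnerProductSpace 𝕜 H]
    [CompleteSpace H] {N : ℕ} (h : OrthonormalBasis (Fin N) 𝕜 H) {σ : Fin N → ℝ} (hσ : Antitone σ)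
    (hσ0 : ∀ i, 0 < σ i) {U : H →L[𝕜] H} (hU : ∀ i, U (h i) = (σ i : 𝕜) • h i) {p : ℝ≥0∞}
    (hp : 0 < p) : schattenNorm p U ≤ eLpNorm σ p Measure.count := by
  have hle (i : Fin N) : ‖singularNumber U i‖ₑ ≤ ‖σ i‖ₑ := by
    have := singularNumber_diagonal_le h hσ hσ0 hU i
    rw [dif_pos i.2] at this
    rw [Real.enorm_of_nonneg (singularNumber_nonneg U i), Real.enorm_of_nonneg (hσ0 i).le]
    exact ENNReal.ofReal_le_ofReal this
  have hzero {n : ℕ} (hn : ¬ n < N) : ‖singularNumber U n‖ₑ = 0 := by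
    have := singularNumber_diagonal_le h hσ hσ0 hU n
    rw [dif_neg hn] at this
    rw [le_antisymm this (singularNumber_nonneg U n), enorm_zero]
  rw [schattenNorm, ellNorm]
  split_ifs with hp'
  · subst hp'
    rw [eLpNorm_exponent_top, eLpNormEssSup_count]
    refine iSup_le fun n => ?_
    by_cases hn : n < N
    · exact (hle ⟨n, hn⟩).trans (le_iSup (fun i => ‖σ i‖ₑ) _)
    · rw [hzero hn]; exact zero_le
  · rw [eLpNorm_eq_lintegral_rpow_enorm_toReal hp.ne' hp', lintegral_count,
      tsum_fintype (fun i : Fin N => _)]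
    have hp0 : 0 < p.toReal := ENNReal.toReal_pos hp.ne' hp'
    refine ENNReal.rpow_le_rpow ?_ (by positivity)
    rw [tsum_eq_sum (s := Finset.range N), Finset.sum_range]
    · gcongr with i
      exact hle i
    · intro n hn
      rw [hzero (by simpa using hn), ENNReal.zero_rpow_of_pos hp0]

/-- A finite rank operator that factors through an operator with a triangular bound factors through
a diagonal operator on a Hilbert space of minimal dimension. -/
theorem exists_schattenFactorizationValues_le {X Y E : Type*} [NormedAddCommGroup X]
    [NormedSpace 𝕜 X] [NormedAddCommGroup Y] [NormedSpace 𝕜 Y] [NormedAddCommGroup E]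
    [InnerProductSpace 𝕜 E] [CompleteSpace E] {p t M : ℝ≥0∞} (ht : 0 < t) (htp : t ≤ p)
    {A : X →L[𝕜] E} {U : E →L[𝕜] E} {B : E →L[𝕜] Y} (hU : TriangularBound p M U)
    {T : X →L[𝕜] Y} (hT : T = B ∘L U ∘L A)
    [FiniteDimensional 𝕜 (T : X →ₗ[𝕜] Y).range] :
    ∃ c ∈ schattenFactorizationValues.{w} t T,
      c ≤ (finrank 𝕜 (T : X →ₗ[𝕜] Y).range : ℝ≥0∞) ^ (t⁻¹.toReal - p⁻¹.toReal) *
        (M * ‖A‖ₑ * ‖B‖ₑ) := by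
  have : CompleteSpace (B : E →ₗ[𝕜] Y).ker := B.isClosed_ker.completeSpace_coe
  let K := (B : E →ₗ[𝕜] Y).ker
  -- Removing the kernel of `B` leaves `B Q = B` and makes `B` injective on `F`, the range of `Q U
  -- A`. Hence `F` has exactly the dimension of the range of `T`.
  let Q : E →L[𝕜] E := Kᗮ.starProjection
  have hBQ (x : E) : B (Q x) = B x := by
    have h1 : x - Q x ∈ K := by
      have := Kᗮ.sub_starProjection_mem_orthogonal x
      rwa [Submodule.orthogonal_orthogonal] at this
    have h2 : B (x - Q x) = 0 := h1
    rw [map_sub, sub_eq_zero] at h2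
    exact h2.symm
  have hQK (x : E) : Q x ∈ Kᗮ := Kᗮ.starProjection_apply_mem x
  let F : Submodule 𝕜 E := ((Q ∘L U ∘L A : X →L[𝕜] E) : X →ₗ[𝕜] E).range
  have hFK : F ≤ Kᗮ := by
    rintro _ ⟨x, rfl⟩
    exact hQK _
  have hBF (x : X) : B (Q (U (A x))) = T x := by rw [hBQ, hT]; rfl
  let L : F →ₗ[𝕜] (T : X →ₗ[𝕜] Y).range :=
    ((B : E →ₗ[𝕜] Y).domRestrict F).codRestrict _ (by
      rintro ⟨_, x, rfl⟩
      exact ⟨x, (hBF x).symm⟩)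
  have hLinj : Function.Injective L := by
    rw [injective_iff_map_eq_zero]
    rintro ⟨y, hy⟩ h0
    have h1 : y ∈ K := congrArg Subtype.val h0
    have h2 : y ∈ K ⊓ Kᗮ := ⟨h1, hFK hy⟩
    rw [Submodule.inf_orthogonal_eq_bot, Submodule.mem_bot] at h2
    exact Subtype.ext h2
  have hLsurj : Function.Surjective L := by
    rintro ⟨_, x, rfl⟩
    exact ⟨⟨_, x, rfl⟩, Subtype.ext (hBF x)⟩
  have : FiniteDimensional 𝕜 F := FiniteDimensional.of_injective L hLinj
  obtain ⟨N, hN⟩ : ∃ N, finrank 𝕜 (T : X →ₗ[𝕜] Y).range = N := ⟨_, rfl⟩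
  have hNF : finrank 𝕜 F = N :=
    (LinearEquiv.ofBijective L ⟨hLinj, hLsurj⟩).finrank_eq.trans hN
  let P : E →L[𝕜] F := F.orthogonalProjectionOnto
  have hP (y : F) (x : E) : ⟪y, P x⟫ = ⟪(y : E), x⟫ :=
    F.inner_orthogonalProjectionOnto_eq_of_mem_left y x
  have hPQ (x : X) : (P (U (A x)) : E) = Q (U (A x)) := by
    have hmem : Q (U (A x)) ∈ F := ⟨x, rfl⟩
    have : P (U (A x)) = ⟨Q (U (A x)), hmem⟩ := by
      refine ext_inner_left 𝕜 fun y => ?_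
      rw [hP, Submodule.coe_inner, ← sub_eq_zero, ← inner_sub_right]
      exact Kᗮ.sub_starProjection_mem_orthogonal _ _ (hFK y.2)
    rw [this]
  -- Since `F ≤ Kᗮ`, `P U A = Q U A`; so `R` is onto `F` and has exactly `N` positive singular
  -- numbers.
  let R : E →L[𝕜] F := P ∘L U
  have hR : Function.Surjective R := by
    rintro ⟨_, x, rfl⟩
    exact ⟨A x, Subtype.ext (hPQ x)⟩
  obtain ⟨σ, v, z, hσ, hσ0, hv, hsvd⟩ := exists_singular_value_decomposition hNF R hR
  obtain ⟨H, i1, i2, ⟨h⟩⟩ := exists_orthonormalBasis_fin.{w} 𝕜 N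
  have hHfin : FiniteDimensional 𝕜 H := h.toBasis.finiteDimensional_of_finite
  have hH : CompleteSpace H := FiniteDimensional.complete 𝕜 H
  let J : H →ₗᵢ[𝕜] E := (h.toBasis.constr 𝕜 v).isometryOfOrthonormal (v := h.toBasis)
    (by rw [h.coe_toBasis]; exact h.orthonormal)
    (by convert hv; funext i; simp)
  have hJ i : J (h i) = v i := by
    change h.toBasis.constr 𝕜 v (h i) = v i
    rw [← h.coe_toBasis, Basis.constr_basis]
  have hz : Orthonormal 𝕜 (fun i => (z i : E)) := z.orthonormal.comp_linearIsometry F.subtypeₗᵢ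
  let W : H →ₗᵢ[𝕜] E := (h.toBasis.constr 𝕜 fun i => (z i : E)).isometryOfOrthonormal
    (v := h.toBasis) (by rw [h.coe_toBasis]; exact h.orthonormal)
    (by convert hz; simp)
  have hW i : W (h i) = z i := by
    change h.toBasis.constr 𝕜 (fun i => (z i : E)) (h i) = z i
    rw [← h.coe_toBasis, Basis.constr_basis]
  let D : H →L[𝕜] H :=
    LinearMap.toContinuousLinearMap (h.toBasis.constr 𝕜 fun i => (σ i : 𝕜) • h i)
  have hD i : D (h i) = (σ i : 𝕜) • h i := by
    have := h.toBasis.constr_basis 𝕜 (fun i => (σ i : 𝕜) • h i) i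
    rwa [h.coe_toBasis] at this
  let J' : E →L[𝕜] H := ContinuousLinearMap.adjoint J.toContinuousLinearMap
  -- Between the singular systems `v` and `z` the matrix of `U` is diagonal with entries `σ i > 0`,
  -- an admissible case of `hU`.
  have hσM : eLpNorm σ p Measure.count ≤ M := by
    have hUv i j : ⟪(z j : E), U (v i)⟫ = if j = i then (σ i : 𝕜) else 0 := by
      rw [← hP, show P (U (v i)) = R (v i) from rfl, hsvd, orthonormal_iff_ite.1 hv]
      split_ifs with hij
      · rw [hij, mul_one]
      · rw [mul_zero]
    have := hU N v (fun i => (z i : E)) hv hz (fun i j hij => by rw [hUv, if_neg hij.ne'])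
      (fun i => by rw [hUv, if_pos rfl]; exact RCLike.ofReal_ne_zero.2 (hσ0 i).ne')
    refine le_trans (le_of_eq (eLpNorm_congr_norm_ae (.of_forall fun i => ?_))) this
    rw [hUv, if_pos rfl, RCLike.norm_ofReal, Real.norm_eq_abs]
  have hσt : schattenNorm t D ≤ (N : ℝ≥0∞) ^ (t⁻¹.toReal - p⁻¹.toReal) * M := by
    refine (schattenNorm_diagonal_le h hσ hσ0 hD ht).trans ?_
    -- Hölder for the counting measure, of total mass `N`. For `N = 0` and `t = p` the factor is
    -- `0^0 = 1`.
    refine (eLpNorm_le_eLpNorm_mul_rpow_measure_univ htp .of_discrete).trans ?_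
    rw [Measure.count_univ, mul_comm, ENat.card_eq_coe_fintype_card, Fintype.card_fin, one_div,
      one_div, ENNReal.toReal_inv, ENNReal.toReal_inv]
    exact mul_le_mul' (le_of_eq (by simp)) hσM
  have hmem : MemSchatten t D := by
    refine ⟨?_, (schattenNorm_diagonal_le h hσ hσ0 hD ht).trans_lt
      (eLpNorm_count_lt_top_of_lt fun i => enorm_lt_top)⟩
    exact ((isCompactOperator_id_iff_finiteDimensional (𝕜 := 𝕜)).2 hHfin).comp_clm D
  refine ⟨_, ⟨H, i1, i2, hH, J' ∘L A, D, B ∘L W.toContinuousLinearMap, hmem, ?_, rfl⟩, ?_⟩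
  · ext x
    have h1 : W (D (J' (A x))) = P (U (A x)) := by
      rw [← z.sum_repr' (P (U (A x))), ← h.sum_repr' (D (J' (A x)))]
      simp only [map_sum, map_smul, hW, Submodule.coe_sum, Submodule.coe_smul]
      refine Finset.sum_congr rfl fun i _ => ?_
      rw [h.inner_diagonal hD, show P (U (A x)) = R (A x) from rfl, hsvd,
        ContinuousLinearMap.adjoint_inner_right]
      simp [hJ]
    rw [← hBF, ← hPQ, ← h1]
    rfl
  · have hA : ‖J' ∘L A‖ₑ ≤ ‖A‖ₑ := by
      rw [← ofReal_norm, ← ofReal_norm]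
      refine ENNReal.ofReal_le_ofReal ((ContinuousLinearMap.opNorm_comp_le _ _).trans ?_)
      refine mul_le_of_le_one_left (norm_nonneg _) ?_
      rw [LinearIsometryEquiv.norm_map]
      exact J.norm_toContinuousLinearMap_le
    have hB : ‖B ∘L W.toContinuousLinearMap‖ₑ ≤ ‖B‖ₑ := by
      rw [← ofReal_norm, ← ofReal_norm]
      refine ENNReal.ofReal_le_ofReal ((ContinuousLinearMap.opNorm_comp_le _ _).trans ?_)
      exact mul_le_of_le_one_right (norm_nonneg _) W.norm_toContinuousLinearMap_le
    rw [hN]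
    calc ‖J' ∘L A‖ₑ * schattenNorm t D * ‖B ∘L W.toContinuousLinearMap‖ₑ
        ≤ ‖A‖ₑ * ((N : ℝ≥0∞) ^ (t⁻¹.toReal - p⁻¹.toReal) * M) * ‖B‖ₑ := by gcongr
      _ = _ := by ring

end FiniteRank

/-! ### Normalized representations and finiteness of `nuTwo`. -/

section Normalization

variable {𝕜 : Type*} [RCLike 𝕜]
variable {X : Type*} [NormedAddCommGroup X] [NormedSpace 𝕜 X]
variable {Y : Type*} [NormedAddCommGroup Y] [NormedSpace 𝕜 Y]

theorem ellNorm_const_mul {p : ℝ≥0∞} (hp : 0 < p) (hp' : p ≠ ∞) (k : 𝕜) (a : ℕ → 𝕜) :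
    ellNorm p (fun n => k * a n) = ‖k‖ₑ * ellNorm p a := by
  have hp0 : 0 < p.toReal := ENNReal.toReal_pos hp.ne' hp'
  rw [ellNorm, if_neg hp', ellNorm, if_neg hp']
  simp only [enorm_mul, ENNReal.mul_rpow_of_nonneg _ _ hp0.le]
  rw [ENNReal.tsum_mul_left, ENNReal.mul_rpow_of_nonneg _ _ (by positivity), ← ENNReal.rpow_mul,
    mul_one_div_cancel hp0.ne', ENNReal.rpow_one]

theorem IsNuclearTwo.nuTwo_lt_top {s : ℝ≥0∞} (hs : 0 < s) (hs' : s ≠ ∞) {T : X →L[𝕜] Y}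
    (hT : IsNuclearTwo s T) : nuTwo s T < ∞ := by
  obtain ⟨a, x', y, ⟨hx', hsum⟩, ha, hy⟩ := hT
  -- The scalar `k` moves from `y` to `a` and normalizes the weak norm; the `+ 1` keeps it nonzero
  -- when that norm vanishes.
  let k : 𝕜 := (((weakTwoNorm 𝕜 y).toReal + 1 : ℝ) : 𝕜)
  have hk1 : (0 : ℝ) < (weakTwoNorm 𝕜 y).toReal + 1 := by positivity
  have hk : k ≠ 0 := RCLike.ofReal_ne_zero.2 hk1.ne'
  have hke : weakTwoNorm 𝕜 y ≤ ‖k‖ₑ := by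
    rw [← ofReal_norm, RCLike.norm_ofReal, abs_of_pos hk1, ← ENNReal.ofReal_toReal hy.ne]
    exact ENNReal.ofReal_le_ofReal (by simp)
  have hfin : ellNorm s (fun n => k * a n) < ∞ := by
    rw [ellNorm_const_mul hs hs']
    exact ENNReal.mul_lt_top enorm_lt_top ha
  refine lt_of_le_of_lt (sInf_le ⟨_, x', fun n => k⁻¹ • y n, ⟨hx', fun x => ?_⟩, ?_, rfl⟩) hfin
  · convert hsum x using 2 with n
    rw [smul_smul, smul_smul, smul_smul]
    congr 1
    field_simp
  · refine iSup₂_le fun y' hy' => ?_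
    simp only [map_smul, smul_eq_mul]
    rw [ellNorm_const_mul (by norm_num) (by norm_num), enorm_inv hk]
    calc ‖k‖ₑ⁻¹ * ellNorm 2 (fun n => y' (y n)) ≤ ‖k‖ₑ⁻¹ * ‖k‖ₑ := by
          gcongr
          exact (le_iSup₂ (f := fun (y' : StrongDual 𝕜 Y) (_ : ‖y'‖ ≤ 1) =>
            ellNorm 2 fun n => y' (y n)) y' hy').trans hke
      _ ≤ 1 := ENNReal.inv_mul_le_one _

theorem exists_represents_of_nuTwo_lt {s c : ℝ≥0∞} {T : X →L[𝕜] Y} (h : nuTwo s T < c) :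
    ∃ (a : ℕ → 𝕜) (x' : ℕ → StrongDual 𝕜 X) (y : ℕ → Y),
      Represents T a x' y ∧ weakTwoNorm 𝕜 y ≤ 1 ∧ ellNorm s a < c := by
  obtain ⟨_, ⟨a, x', y, h1, h2, rfl⟩, h3⟩ := sInf_lt_iff.1 h
  exact ⟨a, x', y, h1, h2, h3⟩

end Normalization

/-! ### Passage to the infimum and conclusion. -/

/-- Bounds by products may be checked on larger factors. -/
theorem ENNReal.le_const_mul_prod_of_forall_lt {ι : Type*} [Fintype ι] {g C : ℝ≥0∞} (hC : C ≠ ∞)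
    {ν : ι → ℝ≥0∞} (hν : ∀ k, ν k < ∞)
    (h : ∀ κ : ι → ℝ≥0∞, (∀ k, κ k < ∞) → (∀ k, ν k < κ k) → g ≤ C * ∏ k, κ k) :
    g ≤ C * ∏ k, ν k := by
  -- All quantities are finite, so the perturbed product is continuous in a common increment `ε` and
  -- the limit `ε → 0` is legitimate.
  lift C to NNReal using hC
  lift ν to ι → NNReal using fun k => (hν k).ne
  have hcont : Filter.Tendsto (fun ε : NNReal => ((C * ∏ k, (ν k + ε) : NNReal) : ℝ≥0∞))
      (nhdsWithin 0 (Set.Ioi 0)) (nhds ((C * ∏ k, (ν k + 0) : NNReal) : ℝ≥0∞)) := by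
    refine ENNReal.tendsto_coe.2 (tendsto_nhdsWithin_of_tendsto_nhds ?_)
    have : Continuous fun ε : NNReal => C * ∏ k, (ν k + ε) := by fun_prop
    exact this.tendsto 0
  have hle : g ≤ ((C * ∏ k, (ν k + 0) : NNReal) : ℝ≥0∞) := by
    refine ge_of_tendsto hcont ?_
    filter_upwards [self_mem_nhdsWithin] with ε hε
    have := h (fun k => ((ν k + ε : NNReal) : ℝ≥0∞)) (fun k => ENNReal.coe_lt_top) fun k =>
      ENNReal.coe_lt_coe.2 (lt_add_of_pos_right (ν k) hε)
    simpa using this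
  simpa using hle

theorem mainTheorem8 {𝕜 : Type*} [RCLike 𝕜] {m : ℕ} (hm : 1 ≤ m)
    (X : Fin (m + 1) → Type u) [∀ i, NormedAddCommGroup (X i)] [∀ i, NormedSpace 𝕜 (X i)]
    [∀ i, CompleteSpace (X i)]
    (s' : Fin m → ℝ≥0∞) (hs' : ∀ k, 0 < s' k ∧ s' k ≤ 2)
    (T : ∀ k : Fin m, X k.castSucc →L[𝕜] X k.succ)
    (hT : ∀ k, IsNuclearTwo (s' k) (T k))
    (s t : ℝ≥0∞) (hs : s⁻¹ = (∑ k, (s' k)⁻¹) - 2⁻¹) (ht : 0 < t) (hts : t ≤ s)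
    (hfin : FiniteDimensional 𝕜 (chainProd X T : X 0 →ₗ[𝕜] X (Fin.last m)).range) :
    FactorsThroughSchatten.{w} t (chainProd X T) ∧
    gammaSchatten.{w} t (chainProd X T) ≤
      (Module.finrank 𝕜 (chainProd X T : X 0 →ₗ[𝕜] X (Fin.last m)).range : ℝ≥0∞) ^
          (t⁻¹.toReal - s⁻¹.toReal) *
        ∏ k, nuTwo (s' k) (T k) := by
  have hν k : nuTwo (s' k) (T k) < ∞ :=
    (hT k).nuTwo_lt_top (hs' k).1 ((hs' k).2.trans_lt (by norm_num)).ne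
  -- The infima defining `nuTwo` need not be attained, so the estimate is proved for arbitrary
  -- larger factors `κ k`.
  have key : ∀ κ : Fin m → ℝ≥0∞, (∀ k, κ k < ∞) → (∀ k, nuTwo (s' k) (T k) < κ k) →
      ∃ c ∈ schattenFactorizationValues.{w} t (chainProd X T),
        c ≤ (Module.finrank 𝕜 (chainProd X T : X 0 →ₗ[𝕜] X (Fin.last m)).range : ℝ≥0∞) ^
          (t⁻¹.toReal - s⁻¹.toReal) * ∏ k, κ k := by
    intro κ hκ hνκ
    have hfac k : ∃ κ' ≤ κ k, HasTriangularFactorization (s' k) κ' (T k) := by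
      obtain ⟨a, x', y, hr, hy, ha⟩ := exists_represents_of_nuTwo_lt (hνκ k)
      exact ⟨_, ha.le, hr.hasTriangularFactorization (hs' k).1 (hs' k).2 hy (ha.trans (hκ k))⟩
    choose κ' hκ' hfac using hfac
    obtain ⟨p, M, A, U, B, hp, hch, hB, hU, hM⟩ :=
      chainProd_hasTriangularFactorization (by omega) X s' κ' T hfac
    -- By `hp` the subtraction defining `s⁻¹` is not truncated; `p = ∞` is included.
    obtain rfl : p = s := by
      rw [← inv_inj, hs, ← hp, ENNReal.add_sub_cancel_right (by simp)]
    obtain ⟨c, hc, hle⟩ := exists_schattenFactorizationValues_le.{w} ht hts hU hch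
    refine ⟨c, hc, hle.trans ?_⟩
    gcongr
    have hB' : ‖B‖ₑ ≤ 1 := by rw [← ofReal_norm]; exact ENNReal.ofReal_le_one.2 hB
    calc M * ‖A‖ₑ * ‖B‖ₑ ≤ (∏ k, κ' k) * 1 := by gcongr
      _ ≤ ∏ k, κ k := by rw [mul_one]; exact Finset.prod_le_prod' fun k _ => hκ' k
  constructor
  · obtain ⟨c, hc, -⟩ := key (fun k => nuTwo (s' k) (T k) + 1)
      (fun k => ENNReal.add_lt_top.2 ⟨hν k, by norm_num⟩)
      (fun k => ENNReal.lt_add_right (hν k).ne one_ne_zero)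
    exact ⟨c, hc⟩
  · refine ENNReal.le_const_mul_prod_of_forall_lt ?_ hν fun κ hκ hνκ => ?_
    -- The exponent is nonnegative because `t ≤ s`, so the constant is finite even for rank zero.
    · refine ENNReal.rpow_ne_top_of_nonneg (sub_nonneg.2 ?_) (ENNReal.natCast_ne_top _)
      exact ENNReal.toReal_mono (ENNReal.inv_ne_top.2 ht.ne') (ENNReal.inv_le_inv.2 hts)
    · obtain ⟨c, hc, hle⟩ := key κ hκ hνκ
      exact (sInf_le hc).trans hle
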